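/- Let $v_0(n)$, $n\ge 0$, be the integers defined by the formal power series identity $$\sum_{n=0}^\infty v_0(n)q^n=\sum_{n=0}^\infty \frac{q^{n^2}(-q;q^2)_n}{(q;q^2)_n},\qquad (a;q)_n=\prod_{i=1}^n(1-aq^{i-1}),$$ and let $$\psi(q)=\sum_{n=0}^\infty q^{n(n+1)/2},\qquad \varphi(q)=\sum_{n=-\infty}^\infty q^{n^2}.$$ Then, as formal power series in $q$ with integer coefficients, $$\sum_{n=0}^\infty v_0(32n+4)\,q^n=3\,\psi(q)+512\,q\,\frac{\psi(q)^9}{\varphi(-q)^8}.$$ -/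

import Mathlib

namespace MockThetaV0

open PowerSeries

/-- The finite `q`-shifted factorial `(a; b)_n = ∏_{i=1}^{n} (1 - a b^{i-1})`
for formal power series `a`, `b` in the variable `q = X`. -/
noncomputable def qPoch (a b : PowerSeries ℤ) (n : ℕ) : PowerSeries ℤ :=
  ∏ i ∈ Finset.range n, (1 - a * b ^ i)

theorem constantCoeff_qPoch (n : ℕ) :
    constantCoeff (qPoch X (X ^ 2) n) = 1 := by
  simp [qPoch, map_prod]

/-- The `n`-th summand `q^{n²} (-q; q²)_n / (q; q²)_n` of the series for `v₀`.
The division is by a power series with constant coefficient `1`. -/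
noncomputable def v0Term (n : ℕ) : PowerSeries ℤ :=
  X ^ (n ^ 2) * qPoch (-X) (X ^ 2) n * invOfUnit (qPoch X (X ^ 2) n) 1

/-- The division in `v0Term` is a genuine one. -/
theorem v0Term_mul_qPoch (n : ℕ) :
    v0Term n * qPoch X (X ^ 2) n = X ^ (n ^ 2) * qPoch (-X) (X ^ 2) n := by
  rw [v0Term, mul_assoc, mul_comm (invOfUnit _ _), mul_invOfUnit _ _ (by
    rw [constantCoeff_qPoch, Units.val_one]), mul_one]

/-- `v₀(m)`: the coefficient of `q^m` in `∑_{n ≥ 0} q^{n²} (-q; q²)_n / (q; q²)_n`.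
The summands with `n > m` do not contribute (see `coeff_v0Term_eq_zero`). -/
noncomputable def v0 (m : ℕ) : ℤ :=
  ∑ n ∈ Finset.range (m + 1), coeff m (v0Term n)

theorem coeff_v0Term_eq_zero {m n : ℕ} (h : m < n) : coeff m (v0Term n) = 0 := by
  have h2 : m < n ^ 2 := by nlinarith
  rw [v0Term, mul_assoc, coeff_X_pow_mul', if_neg (by omega)]

/-- `ψ(q) = ∑_{k ≥ 0} q^{k(k+1)/2}`. -/
noncomputable def psi : PowerSeries ℤ :=
  PowerSeries.mk fun m => (Nat.card {k : ℕ // k * (k + 1) / 2 = m} : ℤ)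

/-- `φ(q) = ∑_{k ∈ ℤ} q^{k²}`. -/
noncomputable def phi : PowerSeries ℤ :=
  PowerSeries.mk fun m => (Nat.card {k : ℤ // k ^ 2 = (m : ℤ)} : ℤ)

/-- `φ(-q)`. -/
noncomputable def phiNeg : PowerSeries ℤ := rescale (-1) phi

theorem constantCoeff_phiNeg : constantCoeff phiNeg = 1 := by
  rw [← coeff_zero_eq_constantCoeff_apply, phiNeg, coeff_rescale, phi, coeff_mk]
  simp

/-- Division by `φ(-q)^8` in `ℤ⟦q⟧` is meaningful. -/
theorem phiNeg_pow_mul_inv : phiNeg ^ 8 * invOfUnit (phiNeg ^ 8) 1 = 1 :=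
  mul_invOfUnit _ _ (by rw [map_pow, constantCoeff_phiNeg, one_pow, Units.val_one])

end MockThetaV0

namespace MockThetaV0

open PowerSeries

/-! Write `V` for the series of `v₀`. The crux is `(V(q) + V(-q) - 1) φ(-q⁴) = φ(q²)²`
(`v0Series_add_rescale_mul`). Put `t_n(d) = ∏_{i<n} q^{2i} (d + q^{2i+2}) / (1 - d q^{2i})` and let
`B(d)` be its sum over all integers `n`, where `t_{-n}(d) = t_n(-d)`. Telescoping gives `(1 + d²)
B(d q²) = (1 - d²) B(d)`. Replacing `d` by `i d` swaps the two factors, so `B(d) B(i d)` is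
invariant under `d ↦ d q²` and equals its value `φ(q²)²` at `d = 0`. At `d = q`, `B(q) = V(q) +
V(-q) - 1`, while `B(i q)` collapses to `φ(-q⁴)`.

The rest is dissection. Two even-part extractions yield `(2E - 1) φ(-q) = φ(q)²` with `E = ∑ v₀(4n)
qⁿ`. Classical theta relations turn the denominators into series in `q⁴`, then in `q²`, so the
progressions `4n + 1` and `2n` can be read off (`decim_sixteen_mul_phiNeg_pow`,
`decim_thirtyTwo_mul_phiNeg_pow`). -/

/-- The generating function `∑ i, q ^ f i` of a function with finite fibres. -/
noncomputable def genFun {ι : Type*} (f : ι → ℕ) : PowerSeries ℤ :=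
  PowerSeries.mk fun m => (Nat.card {i // f i = m} : ℤ)

/-- All fibres of `f` are finite. -/
def FiniteFibers {ι : Type*} (f : ι → ℕ) : Prop := ∀ m, Finite {i // f i = m}

theorem FiniteFibers.add {ι κ : Type*} {f : ι → ℕ} {g : κ → ℕ} (hf : FiniteFibers f)
    (hg : FiniteFibers g) : FiniteFibers fun p : ι × κ => f p.1 + g p.2 := by
  intro m
  have hf' : {i | f i ≤ m}.Finite := by
    have : {i | f i ≤ m} = ⋃ a ∈ Set.Iic m, {i | f i = a} := by ext; simp
    rw [this]
    exact (Set.finite_Iic m).biUnion fun a _ => Set.finite_coe_iff.mp (hf a)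
  have hg' : {i | g i ≤ m}.Finite := by
    have : {i | g i ≤ m} = ⋃ a ∈ Set.Iic m, {i | g i = a} := by ext; simp
    rw [this]
    exact (Set.finite_Iic m).biUnion fun a _ => Set.finite_coe_iff.mp (hg a)
  refine ((hf'.prod hg').subset ?_ : {p : ι × κ | f p.1 + g p.2 = m}.Finite)
  rintro ⟨i, j⟩ h
  simp only [Set.mem_ofPred_eq] at h
  simp only [Set.mem_prod, Set.mem_ofPred_eq]
  omega

theorem FiniteFibers.mul_left {ι : Type*} {f : ι → ℕ} (hf : FiniteFibers f) {k : ℕ}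
    (hk : k ≠ 0) : FiniteFibers fun i => k * f i := by
  intro m
  have := hf (m / k)
  refine Finite.of_injective
    (fun i : {i // k * f i = m} => (⟨i.1, (Nat.div_eq_of_eq_mul_right (by omega) i.2.symm).symm⟩ :
      {i // f i = m / k})) ?_
  rintro ⟨a, ha⟩ ⟨b, hb⟩ h
  simpa using h

theorem genFun_eq_add_of_bijective {ι₁ ι₂ κ : Type*} {g : κ → ℕ} (hg : FiniteFibers g)
    (e₁ : ι₁ → κ) (e₂ : ι₂ → κ) (he : Function.Bijective (Sum.elim e₁ e₂)) :
    genFun g = genFun (g ∘ e₁) + genFun (g ∘ e₂) := by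
  ext m
  simp only [genFun, coeff_mk, map_add]
  have h1 : Function.Injective e₁ := fun a b h => by
    simpa using he.1 (a₁ := Sum.inl a) (a₂ := Sum.inl b) (by simpa using h)
  have h2 : Function.Injective e₂ := fun a b h => by
    simpa using he.1 (a₁ := Sum.inr a) (a₂ := Sum.inr b) (by simpa using h)
  have := hg m
  have f1 : Finite {i // (g ∘ e₁) i = m} :=
    Finite.of_injective (fun i => (⟨e₁ i.1, i.2⟩ : {k // g k = m}))
      fun a b h => Subtype.ext (h1 (by simpa using h))
  have f2 : Finite {i // (g ∘ e₂) i = m} :=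
    Finite.of_injective (fun i => (⟨e₂ i.1, i.2⟩ : {k // g k = m}))
      fun a b h => Subtype.ext (h2 (by simpa using h))
  rw [← Nat.cast_add, ← Nat.card_sum]
  congr 1
  refine (Nat.card_congr (Equiv.ofBijective
    (Sum.elim (fun i => (⟨e₁ i.1, i.2⟩ : {k // g k = m})) (fun i => ⟨e₂ i.1, i.2⟩))
    ⟨?_, ?_⟩)).symm
  · rintro (⟨a, ha⟩ | ⟨a, ha⟩) (⟨b, hb⟩ | ⟨b, hb⟩) h
    · simpa using h1 (by simpa using h)
    · simpa using he.1 (a₁ := Sum.inl a) (a₂ := Sum.inr b) (by simpa using h)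
    · simpa using he.1 (a₁ := Sum.inr a) (a₂ := Sum.inl b) (by simpa using h)
    · simpa using h2 (by simpa using h)
  · rintro ⟨k, hk⟩
    obtain ⟨i | i, rfl⟩ := he.2 k
    · exact ⟨Sum.inl ⟨i, hk⟩, rfl⟩
    · exact ⟨Sum.inr ⟨i, hk⟩, rfl⟩

theorem genFun_mul {ι κ : Type*} {f : ι → ℕ} {g : κ → ℕ} (hf : FiniteFibers f)
    (hg : FiniteFibers g) :
    genFun f * genFun g = genFun fun p : ι × κ => f p.1 + g p.2 := by
  ext m
  simp only [genFun, coeff_mk, coeff_mul]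
  have e : {p : ι × κ // f p.1 + g p.2 = m} ≃
      Σ ab : {ab : ℕ × ℕ // ab ∈ Finset.HasAntidiagonal.antidiagonal m}, {i // f i = ab.1.1} × {j // g j = ab.1.2} :=
    { toFun := fun p => ⟨⟨(f p.1.1, g p.1.2), by simpa using p.2⟩, ⟨p.1.1, rfl⟩, ⟨p.1.2, rfl⟩⟩
      invFun := fun s => ⟨(s.2.1.1, s.2.2.1), by
        rw [s.2.1.2, s.2.2.2]; exact Finset.HasAntidiagonal.mem_antidiagonal.mp s.1.2⟩
      left_inv := fun p => rfl
      right_inv := by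
        rintro ⟨⟨⟨a, b⟩, h⟩, ⟨i, hi⟩, ⟨j, hj⟩⟩
        dsimp only at hi hj
        subst hi hj
        rfl }
  have := fun m => hf m
  have := fun m => hg m
  rw [Nat.card_congr e, Nat.card_sigma, Finset.sum_coe_sort (Finset.HasAntidiagonal.antidiagonal m)
    (fun ab => Nat.card ({i // f i = ab.1} × {j // g j = ab.2}))]
  push_cast [Nat.card_prod]
  rfl

theorem expand_genFun {ι : Type*} (f : ι → ℕ) {k : ℕ} (hk : k ≠ 0) :
    expand k hk (genFun f) = genFun fun i => k * f i := by
  ext m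
  rw [coeff_expand]
  simp only [genFun, coeff_mk]
  split_ifs with h
  · obtain ⟨r, rfl⟩ := h
    rw [Nat.mul_div_cancel_left _ (by omega)]
    simp [hk]
  · have : IsEmpty {i // k * f i = m} := ⟨fun i => h ⟨_, i.2.symm⟩⟩
    simp

theorem X_pow_mul_genFun {ι : Type*} (f : ι → ℕ) (k : ℕ) :
    X ^ k * genFun f = genFun fun i => f i + k := by
  ext m
  rw [coeff_X_pow_mul']
  simp only [genFun, coeff_mk]
  split_ifs with h
  · have : ∀ i, f i = m - k ↔ f i + k = m := by omega
    simp [this]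
  · have : IsEmpty {i // f i + k = m} := ⟨fun i => h (by have := i.2; omega)⟩
    simp

/-! ### Theta function identities from bijections of index sets. -/

/-- The triangular numbers, indexed by all integers. -/
def triangular (k : ℤ) : ℕ := (k * (k + 1) / 2).toNat

theorem two_mul_triangular (k : ℤ) : (2 * triangular k : ℤ) = k * (k + 1) := by
  have h : 2 ∣ k * (k + 1) := (Int.even_mul_succ_self k).two_dvd
  have h0 : 0 ≤ k * (k + 1) := by
    rcases le_or_gt 0 k with hk | hk
    · positivity
    · nlinarith
  rw [triangular, Int.toNat_of_nonneg (by omega)]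
  omega

theorem finiteFibers_natAbs_sq : FiniteFibers fun k : ℤ => k.natAbs ^ 2 := by
  intro m
  refine ((Set.finite_Icc (-m : ℤ) m).subset ?_ : {k : ℤ | k.natAbs ^ 2 = m}.Finite)
  rintro k rfl
  have h : k.natAbs ≤ k.natAbs ^ 2 := Nat.le_self_pow (by norm_num) _
  simp only [Set.mem_Icc]
  omega

theorem finiteFibers_triangular : FiniteFibers triangular := by
  intro m
  refine ((Set.finite_Icc (-(2 * m + 1) : ℤ) (2 * m + 1)).subset ?_ :
    {k : ℤ | triangular k = m}.Finite)
  rintro k rfl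
  have h := two_mul_triangular k
  simp only [Set.mem_Icc]
  constructor
  · nlinarith [sq_nonneg (k + 1)]
  · nlinarith [sq_nonneg k]

theorem phi_eq_genFun : phi = genFun fun k : ℤ => k.natAbs ^ 2 := by
  ext m
  simp only [phi, genFun, coeff_mk]
  have : ∀ k : ℤ, k ^ 2 = (m : ℤ) ↔ k.natAbs ^ 2 = m := by
    intro k
    rw [← Int.natAbs_sq]
    norm_cast
  simp [this]

/-- The involution `k ↦ -k - 1` preserves triangular numbers and exchanges `k ≥ 0` with `k < 0`. -/
theorem genFun_triangular : genFun triangular = 2 * psi := by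
  have hb : Function.Bijective
      (Sum.elim (fun n : ℕ => (n : ℤ)) (fun n : ℕ => -(n : ℤ) - 1)) := by
    constructor
    · rintro (a | a) (b | b) h <;> simp at h ⊢ <;> omega
    · intro k
      rcases le_or_gt 0 k with hk | hk
      · exact ⟨Sum.inl k.toNat, by simp [hk]⟩
      · exact ⟨Sum.inr (-k - 1).toNat, by simp; omega⟩
  have h1 : ∀ n : ℕ, triangular n = n * (n + 1) / 2 := by
    intro n
    have h : 2 * triangular n = n * (n + 1) := by exact_mod_cast two_mul_triangular n
    exact (Nat.div_eq_of_eq_mul_right (by norm_num) h.symm).symm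
  have h2 : ∀ n : ℕ, triangular (-(n : ℤ) - 1) = n * (n + 1) / 2 := by
    intro n
    have h := two_mul_triangular (-(n : ℤ) - 1)
    have h' : (-(n : ℤ) - 1) * (-(n : ℤ) - 1 + 1) = n * (n + 1) := by ring
    rw [h'] at h
    norm_cast at h
    exact (Nat.div_eq_of_eq_mul_right (by norm_num) h.symm).symm
  rw [genFun_eq_add_of_bijective finiteFibers_triangular _ _ hb, two_mul]
  congr 1
  simp only [Function.comp_def, h2]
  rfl

/-- Split by the parity of `k`, using `(2n + 1)² = 8 T_n + 1`. -/
theorem phi_eq_expand_four :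
    phi = expand 4 (by norm_num) phi + 2 * X * expand 8 (by norm_num) psi := by
  have hb : Function.Bijective
      (Sum.elim (fun n : ℤ => 2 * n) (fun n : ℤ => 2 * n + 1)) := by
    constructor
    · rintro (a | a) (b | b) h <;> simp at h ⊢ <;> omega
    · intro k
      rcases Int.even_or_odd' k with ⟨c, hc | hc⟩
      · exact ⟨Sum.inl c, by simp [hc]⟩
      · exact ⟨Sum.inr c, by simp [hc]⟩
  have h : (2 : ℤ⟦X⟧) * X * expand 8 (by norm_num) psi =
      X ^ 1 * expand 8 (by norm_num) (genFun triangular) := by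
    rw [genFun_triangular, map_mul, map_ofNat]; ring
  rw [h, phi_eq_genFun, expand_genFun, expand_genFun, X_pow_mul_genFun,
    genFun_eq_add_of_bijective finiteFibers_natAbs_sq _ _ hb]
  congr 2
  · funext n
    zify
    simp [abs_mul, mul_pow]
  · funext n
    have := two_mul_triangular n
    zify
    simp
    linear_combination -4 * this

/-- Split the pairs `(k, l)` by the parity of `k + l` and rotate the lattice by 45 degrees. -/
theorem phi_sq_eq :
    phi ^ 2 = expand 2 (by norm_num) phi ^ 2 + 4 * X * expand 4 (by norm_num) psi ^ 2 := by
  have hb : Function.Bijective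
      (Sum.elim (fun n : ℤ × ℤ => (n.1 + n.2, n.1 - n.2))
        (fun n : ℤ × ℤ => (n.1 + n.2 + 1, n.1 - n.2))) := by
    constructor
    · rintro (⟨a, c⟩ | ⟨a, c⟩) (⟨b, d⟩ | ⟨b, d⟩) h <;> simp at h ⊢ <;> omega
    · rintro ⟨k, l⟩
      rcases Int.even_or_odd' (k + l) with ⟨c, hc | hc⟩
      · exact ⟨Sum.inl (c, k - c), by simp; omega⟩
      · exact ⟨Sum.inr (c, k - c - 1), by simp; omega⟩
  have h : (4 : ℤ⟦X⟧) * X * expand 4 (by norm_num) psi ^ 2 =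
      X ^ 1 * (expand 4 (by norm_num) (genFun triangular) *
        expand 4 (by norm_num) (genFun triangular)) := by
    rw [genFun_triangular, map_mul, map_ofNat]; ring
  have hf := finiteFibers_natAbs_sq
  have hf2 := hf.mul_left (k := 2) (by norm_num)
  have hg4 := finiteFibers_triangular.mul_left (k := 4) (by norm_num)
  rw [h, phi_eq_genFun, sq, sq, expand_genFun, expand_genFun, genFun_mul hf hf,
    genFun_mul hf2 hf2, genFun_mul hg4 hg4, X_pow_mul_genFun,
    genFun_eq_add_of_bijective (hf.add hf) _ _ hb]
  congr 2
  · funext n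
    zify
    simp
    ring
  · funext n
    have h1 := two_mul_triangular n.1
    have h2 := two_mul_triangular n.2
    zify
    simp
    linear_combination -2 * h1 - 2 * h2

/-- Since `T_{b+a} + T_{b-a} = a² + 2 T_b`, each parity class of `k + l` contributes the same
series; `T_{-k-1} = T_k` handles the odd class. -/
theorem phi_mul_expand_psi : phi * expand 2 (by norm_num) psi = psi ^ 2 := by
  have hb : Function.Bijective
      (Sum.elim (fun n : ℤ × ℤ => (n.2 + n.1, n.2 - n.1))
        (fun n : ℤ × ℤ => (n.1 + n.2, n.1 - n.2 - 1))) := by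
    constructor
    · rintro (⟨a, c⟩ | ⟨a, c⟩) (⟨b, d⟩ | ⟨b, d⟩) h <;> simp at h ⊢ <;> omega
    · rintro ⟨k, l⟩
      rcases Int.even_or_odd' (k + l) with ⟨c, hc | hc⟩
      · exact ⟨Sum.inl (k - c, c), by simp; omega⟩
      · exact ⟨Sum.inr (c + 1, k - c - 1), by simp; omega⟩
  have hf := finiteFibers_natAbs_sq
  have hg := finiteFibers_triangular
  have hg2 := hg.mul_left (k := 2) (by norm_num)
  have key : genFun triangular * genFun triangular =
      2 * (genFun (fun k : ℤ => k.natAbs ^ 2) *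
        expand 2 (by norm_num) (genFun triangular)) := by
    rw [genFun_mul hg hg, genFun_eq_add_of_bijective (hg.add hg) _ _ hb, expand_genFun,
      genFun_mul hf hg2, two_mul]
    congr 2
    · funext n
      have h1 := two_mul_triangular (n.2 + n.1)
      have h2 := two_mul_triangular (n.2 - n.1)
      have h3 := two_mul_triangular n.2
      zify
      simp
      linarith
    · funext n
      have h1 := two_mul_triangular (n.1 + n.2)
      have h2 := two_mul_triangular (n.1 - n.2 - 1)
      have h3 := two_mul_triangular n.2
      zify
      simp
      linarith
  rw [← phi_eq_genFun, genFun_triangular, map_mul, map_ofNat] at key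
  have h4 : (4 : ℤ⟦X⟧) ≠ 0 := by
    intro h
    have := congrArg constantCoeff h
    rw [map_ofNat, map_zero] at this
    norm_num at this
  exact mul_left_cancel₀ h4 (by linear_combination -key)

/-! ### The bilateral sum and its functional equation. -/

section Bilateral

variable {K : Type*} [Field K]

/-- The summand `∏_{i<n} q^{2i} (d + q^{2i+2}) / (1 - d q^{2i})`. -/
noncomputable def bilTerm (d : K⟦X⟧) (n : ℕ) : K⟦X⟧ :=
  ∏ i ∈ Finset.range n, X ^ (2 * i) * (d + X ^ (2 * i + 2)) * (1 - d * X ^ (2 * i))⁻¹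

theorem bilTerm_zero (d : K⟦X⟧) : bilTerm d 0 = 1 := by simp [bilTerm]

theorem bilTerm_succ (d : K⟦X⟧) (n : ℕ) :
    bilTerm d (n + 1) =
      bilTerm d n * (X ^ (2 * n) * (d + X ^ (2 * n + 2)) * (1 - d * X ^ (2 * n))⁻¹) := by
  rw [bilTerm, Finset.prod_range_succ, bilTerm]

theorem one_sub_mul_inv {d : K⟦X⟧} (hd : constantCoeff d = 0) (n : ℕ) :
    (1 - d * X ^ n) * (1 - d * X ^ n)⁻¹ = 1 :=
  PowerSeries.mul_inv_cancel _ (by simp [hd])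

theorem bilTerm_shift_succ {d : K⟦X⟧} (hd : constantCoeff d = 0) (n : ℕ) :
    bilTerm (d * X ^ 2) (n + 1) = bilTerm d n * X ^ (4 * n + 2) * (1 - d ^ 2) *
      (1 - d * X ^ (2 * n))⁻¹ * (1 - d * X ^ (2 * n + 2))⁻¹ := by
  induction n with
  | zero =>
    have h := one_sub_mul_inv hd 0
    simp only [bilTerm_succ, bilTerm_zero, Nat.mul_zero, Nat.zero_add, pow_zero, mul_one,
      one_mul] at h ⊢
    linear_combination -(X ^ 2 * (1 + d) * (1 - d * X ^ 2)⁻¹) * h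
  | succ n ih =>
    have e : d * X ^ 2 * X ^ (2 * (n + 1)) = d * X ^ (2 * (n + 1) + 2) := by ring
    rw [bilTerm_succ, ih, bilTerm_succ d n, e, show 2 * (n + 1) = 2 * n + 2 by ring]
    ring

/-- Finite form of the functional equation for one half of the sum. The boundary term `-d (1 - d)`
is not even in `d`; adding the case `-d` leaves `2 d²`, which the `-1` in `bilSum` absorbs. -/
theorem sum_bilTerm_shift {d : K⟦X⟧} (hd : constantCoeff d = 0) (N : ℕ) :
    (1 + d ^ 2) * ∑ n ∈ Finset.range (N + 1), bilTerm (d * X ^ 2) n =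
      (1 - d ^ 2) * ∑ n ∈ Finset.range (N + 1), bilTerm d n - d * (1 - d) +
        d * (1 - d ^ 2) * (X ^ (2 * N) * bilTerm d N * (1 - d * X ^ (2 * N))⁻¹) := by
  induction N with
  | zero =>
    have h := one_sub_mul_inv hd 0
    simp only [Nat.zero_add, Finset.sum_range_one, bilTerm_zero, Nat.mul_zero, pow_zero,
      mul_one, one_mul] at h ⊢
    linear_combination -(d * (1 + d)) * h
  | succ N ih =>
    have h := one_sub_mul_inv hd (2 * N + 2)
    rw [Finset.sum_range_succ, mul_add, ih, Finset.sum_range_succ _ (N + 1),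
      bilTerm_shift_succ hd, bilTerm_succ d N, show 2 * (N + 1) = 2 * N + 2 by ring]
    linear_combination ((1 - d ^ 2) * bilTerm d N * X ^ (4 * N + 2) *
      (1 - d * X ^ (2 * N))⁻¹) * h

/-- Truncation of the bilateral sum attached to `bilTerm`. -/
noncomputable def bilSum (N : ℕ) (d : K⟦X⟧) : K⟦X⟧ :=
  ∑ n ∈ Finset.range N, bilTerm d n + ∑ n ∈ Finset.range N, bilTerm (-d) n - 1

theorem X_pow_dvd_bilSum_shift {d : K⟦X⟧} (hd : constantCoeff d = 0) (N : ℕ) :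
    X ^ (2 * N) ∣ (1 + d ^ 2) * bilSum (N + 1) (d * X ^ 2) - (1 - d ^ 2) * bilSum (N + 1) d := by
  have h1 := sum_bilTerm_shift hd N
  have h2 := sum_bilTerm_shift (d := -d) (by simp [hd]) N
  rw [neg_mul] at h2
  refine ⟨d * (1 - d ^ 2) * (bilTerm d N * (1 - d * X ^ (2 * N))⁻¹) -
    d * (1 - d ^ 2) * (bilTerm (-d) N * (1 - -d * X ^ (2 * N))⁻¹), ?_⟩
  simp only [bilSum]
  linear_combination h1 + h2

/-- At `d = 0` the product is `∏ q^{4i+2} = q^{2n²}`; this is the `X`-adic form of letting `d` tend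
to `0`. -/
theorem X_pow_dvd_bilTerm_sub {M : ℕ} {d : K⟦X⟧} (hd : constantCoeff d = 0) (h : X ^ M ∣ d)
    (n : ℕ) : X ^ M ∣ bilTerm d n - X ^ (2 * n ^ 2) := by
  induction n with
  | zero => simp [bilTerm_zero]
  | succ n ih =>
    have hw := one_sub_mul_inv hd (2 * n)
    obtain ⟨a, ha⟩ := ih
    obtain ⟨b, hb⟩ := h
    refine ⟨a * (X ^ (2 * n) * (d + X ^ (2 * n + 2)) * (1 - d * X ^ (2 * n))⁻¹) +
      X ^ (2 * n ^ 2) * X ^ (2 * n) * (b * (1 - d * X ^ (2 * n))⁻¹ +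
        X ^ (2 * n + 2) * (b * X ^ (2 * n) * (1 - d * X ^ (2 * n))⁻¹)), ?_⟩
    rw [bilTerm_succ]
    generalize (1 - d * X ^ (2 * n))⁻¹ = w at *
    linear_combination (X ^ (2 * n) * (d + X ^ (2 * n + 2)) * w) * ha +
      (X ^ (2 * n ^ 2) * X ^ (2 * n) * w + X ^ (2 * n ^ 2) * X ^ (2 * n) * X ^ (2 * n + 2) *
        X ^ (2 * n) * w) * hb + (X ^ (2 * n ^ 2) * X ^ (2 * n) * X ^ (2 * n + 2)) * hw

theorem X_pow_dvd_bilSum_sub {M : ℕ} {d : K⟦X⟧} (hd : constantCoeff d = 0) (h : X ^ M ∣ d)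
    (N : ℕ) :
    X ^ M ∣ bilSum N d - (2 * ∑ n ∈ Finset.range N, X ^ (2 * n ^ 2) - 1) := by
  have h1 : X ^ M ∣ ∑ n ∈ Finset.range N, (bilTerm d n - X ^ (2 * n ^ 2)) :=
    Finset.dvd_sum fun n _ => X_pow_dvd_bilTerm_sub hd h n
  have h2 : X ^ M ∣ ∑ n ∈ Finset.range N, (bilTerm (-d) n - X ^ (2 * n ^ 2)) :=
    Finset.dvd_sum fun n _ => X_pow_dvd_bilTerm_sub (by simp [hd]) (by simpa using h) n
  convert dvd_add h1 h2 using 1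
  simp only [bilSum, Finset.sum_sub_distrib]
  ring

theorem X_pow_dvd_of_mul {M : ℕ} {u a : K⟦X⟧} (hu : constantCoeff u ≠ 0)
    (h : X ^ M ∣ u * a) : X ^ M ∣ a := by
  have := h.mul_left u⁻¹
  rwa [← mul_assoc, PowerSeries.inv_mul_cancel _ hu, one_mul] at this

theorem X_pow_dvd_mul_sub_mul {M : ℕ} {a a' b b' : K⟦X⟧} (ha : X ^ M ∣ a - a')
    (hb : X ^ M ∣ b - b') : X ^ M ∣ a * b - a' * b' := by
  convert dvd_add (ha.mul_right b) (hb.mul_left a') using 1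
  ring

theorem X_pow_dvd_bilSum_mul_bilSum {c : K} (hc : c ^ 2 = -1) {M N : ℕ} (hM : M ≤ 2 * N)
    (J : ℕ) :
    X ^ M ∣ bilSum (N + 1) (X ^ (2 * J + 1)) * bilSum (N + 1) (C c * X ^ (2 * J + 1)) -
      bilSum (N + 1) X * bilSum (N + 1) (C c * X) := by
  induction J with
  | zero => simp
  | succ J ih =>
    have hc' : (C c : K⟦X⟧) ^ 2 = -1 := by rw [← map_pow, hc, map_neg, map_one]
    have h1 := (pow_dvd_pow X hM).trans
      (X_pow_dvd_bilSum_shift (K := K) (d := X ^ (2 * J + 1)) (by simp) N)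
    have h2 := (pow_dvd_pow X hM).trans
      (X_pow_dvd_bilSum_shift (K := K) (d := C c * X ^ (2 * J + 1)) (by simp) N)
    have e1 : (X : K⟦X⟧) ^ (2 * J + 1) * X ^ 2 = X ^ (2 * (J + 1) + 1) := by ring
    rw [mul_assoc, mul_pow, hc', e1] at h2
    rw [e1] at h1
    set s : K⟦X⟧ := (X ^ (2 * J + 1)) ^ 2 with hs
    -- With `s = d²`, the shift factors for `d` and `c d` are `(1 + s, 1 - s)` and `(1 - s, 1 + s)`;
    -- their common product is a unit and cancels.
    refine (dvd_add (X_pow_dvd_of_mul (u := (1 + s) * (1 - s)) (by simp [hs]) ?_) ih).trans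
      (dvd_of_eq (sub_add_sub_cancel _ _ _))
    convert dvd_add (h1.mul_right
      ((1 - s) * bilSum (N + 1) (C c * X ^ (2 * (J + 1) + 1))))
      (h2.mul_left ((1 - s) * bilSum (N + 1) (X ^ (2 * J + 1)))) using 1
    ring

theorem X_pow_dvd_bilSum_mul_bilSum_sub_sq {c : K} (hc : c ^ 2 = -1) {M N : ℕ}
    (hM : M ≤ 2 * N) :
    X ^ M ∣ bilSum (N + 1) X * bilSum (N + 1) (C c * X) -
      (2 * ∑ n ∈ Finset.range (N + 1), X ^ (2 * n ^ 2) - 1) ^ 2 := by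
  -- After `M` shifts `d` is a multiple of `X^(2M+1)`, hence zero modulo `X^M`.
  have h := X_pow_dvd_bilSum_mul_bilSum hc hM M
  have hX : (X : K⟦X⟧) ^ M ∣ X ^ (2 * M + 1) := pow_dvd_pow X (by omega)
  have h2 := X_pow_dvd_mul_sub_mul
    (X_pow_dvd_bilSum_sub (K := K) (by simp) hX (N + 1))
    (X_pow_dvd_bilSum_sub (d := C c * X ^ (2 * M + 1)) (by simp) (hX.mul_left _) (N + 1))
  convert dvd_sub h2 h using 1
  ring

/-- As `c² = -1`, `c q + q^{2i+2} = c q (1 - c q^{2i+1})`, which cancels the denominator. -/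
theorem bilTerm_C_mul_X {c : K} (hc : c ^ 2 = -1) (n : ℕ) :
    bilTerm (C c * X) n = C c ^ n * X ^ (n ^ 2) := by
  have hc' : (C c : K⟦X⟧) ^ 2 = -1 := by rw [← map_pow, hc, map_neg, map_one]
  induction n with
  | zero => simp [bilTerm_zero]
  | succ n ih =>
    have hw := one_sub_mul_inv (d := (C c * X : K⟦X⟧)) (by simp) (2 * n)
    rw [bilTerm_succ, ih]
    generalize (1 - C c * X * X ^ (2 * n))⁻¹ = w at *
    linear_combination (C c ^ (n + 1) * X ^ ((n + 1) ^ 2)) * hw +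
      (C c ^ n * X ^ (n ^ 2) * X ^ (4 * n + 2) * w) * hc'

/-- Odd `n` cancel between `c` and `-c`, and `n = 2k` gives `(-1)^k q^{4k²}` twice. -/
theorem bilSum_C_mul_X {c : K} (hc : c ^ 2 = -1) (M : ℕ) :
    bilSum (2 * M) (C c * X) = 2 * ∑ k ∈ Finset.range M, (-1) ^ k * X ^ (4 * k ^ 2) - 1 := by
  have hc' : (C c : K⟦X⟧) ^ 2 = -1 := by rw [← map_pow, hc, map_neg, map_one]
  have hneg : -(C c * X : K⟦X⟧) = C (-c) * X := by simp
  have h1 := fun n => bilTerm_C_mul_X (n := n) hc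
  have h2 : ∀ n, bilTerm (C (-c) * X) n = (-C c) ^ n * X ^ (n ^ 2) := fun n => by
    rw [bilTerm_C_mul_X (by rw [neg_sq, hc]), map_neg]
  rw [bilSum, hneg, ← Finset.sum_add_distrib]
  congr 1
  induction M with
  | zero => simp
  | succ M ih =>
    rw [show 2 * (M + 1) = 2 * M + 1 + 1 by ring, Finset.sum_range_succ, Finset.sum_range_succ,
      ih, Finset.sum_range_succ]
    simp only [h1, h2, pow_succ (C c) (2 * M), pow_succ (-C c) (2 * M), pow_mul (C c) 2 M,
      pow_mul (-C c) 2 M, neg_sq, hc']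
    ring

theorem rescale_inv (a : K) {f : K⟦X⟧} (hf : constantCoeff f ≠ 0) :
    rescale a f⁻¹ = (rescale a f)⁻¹ := by
  rw [PowerSeries.eq_inv_iff_mul_eq_one (by
    rw [← coeff_zero_eq_constantCoeff_apply, coeff_rescale]; simpa using hf), ← map_mul,
    PowerSeries.inv_mul_cancel _ hf, map_one]

theorem rescale_bilTerm_X (n : ℕ) : rescale (-1) (bilTerm (X : K⟦X⟧) n) = bilTerm (-X) n := by
  rw [bilTerm, map_prod, bilTerm]
  refine Finset.prod_congr rfl fun i _ => ?_
  rw [map_mul, rescale_inv _ (by simp)]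
  simp [(even_two_mul i).neg_pow, pow_add]

end Bilateral

/-! ### From truncated sums to the identity for `V(q) + V(-q)`. -/

/-- The generating function of `v₀`. -/
noncomputable def v0Series : ℤ⟦X⟧ := PowerSeries.mk v0

theorem map_v0Term {K : Type*} [Field K] (n : ℕ) :
    map (Int.castRingHom K) (v0Term n) = bilTerm X n := by
  have h := congrArg (map (Int.castRingHom K)) (v0Term_mul_qPoch n)
  have h2 : bilTerm X n * map (Int.castRingHom K) (qPoch X (X ^ 2) n) =
      map (Int.castRingHom K) (X ^ (n ^ 2) * qPoch (-X) (X ^ 2) n) := by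
    simp only [qPoch, map_mul, map_prod, map_sub, map_one, map_pow, map_X, map_neg]
    induction n with
    | zero => simp [bilTerm_zero]
    | succ n ih =>
      have hw := one_sub_mul_inv (d := (X : K⟦X⟧)) (by simp) (2 * n)
      simp only [bilTerm_succ, Finset.prod_range_succ, ← pow_mul] at ih ⊢
      generalize (1 - X * X ^ (2 * n) : K⟦X⟧)⁻¹ = w at *
      linear_combination (X ^ (2 * n) * (X + X ^ (2 * n + 2)) * w * (1 - X * X ^ (2 * n))) *
        ih (congrArg _ (v0Term_mul_qPoch n)) +
        (X ^ (n ^ 2) * (∏ x ∈ Finset.range n, (1 - -X * X ^ (2 * x))) *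
          (X ^ (2 * n) * (X + X ^ (2 * n + 2)))) * hw
  rw [← h2, map_mul] at h
  refine mul_right_cancel₀ ?_ h
  intro h0
  have := congrArg (coeff 0) h0
  rw [coeff_map, coeff_zero_eq_constantCoeff_apply, constantCoeff_qPoch] at this
  simp at this

theorem X_pow_dvd_v0Series_sub (M : ℕ) :
    X ^ M ∣ v0Series - ∑ n ∈ Finset.range M, v0Term n := by
  rw [X_pow_dvd_iff]
  intro m hm
  rw [map_sub, v0Series, coeff_mk, v0, map_sum, sub_eq_zero]
  refine Finset.sum_subset (by simpa using hm) fun n _ hn => coeff_v0Term_eq_zero ?_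
  simp at hn
  omega

theorem X_pow_dvd_genFun_sub {f : ℕ → ℕ} (hf : ∀ n, n ≤ f n) (M : ℕ) :
    X ^ M ∣ genFun f - ∑ n ∈ Finset.range M, X ^ f n := by
  rw [X_pow_dvd_iff]
  intro m hm
  rw [map_sub, genFun, coeff_mk, map_sum, sub_eq_zero]
  simp only [coeff_X_pow]
  rw [Finset.sum_boole, Nat.subtype_card]
  intro n
  have := hf n
  simp only [Finset.mem_filter, Finset.mem_range]
  omega

theorem X_pow_dvd_phi_sub_range_succ (M : ℕ) :
    X ^ M ∣ phi - (2 * ∑ n ∈ Finset.range (M + 1), X ^ (n ^ 2) - 1) := by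
  have hb : Function.Bijective
      (Sum.elim (fun n : ℕ => (n : ℤ)) (fun n : ℕ => -((n : ℤ) + 1))) := by
    constructor
    · rintro (a | a) (b | b) h <;> simp at h ⊢ <;> omega
    · intro k
      rcases le_or_gt 0 k with hk | hk
      · exact ⟨Sum.inl k.toNat, by simp [hk]⟩
      · exact ⟨Sum.inr (-k - 1).toNat, by simp; omega⟩
  have h1 := X_pow_dvd_genFun_sub (f := fun n => n ^ 2)
    (fun n => Nat.le_self_pow (by norm_num) n) (M + 1)
  have h2 := X_pow_dvd_genFun_sub (f := fun n => (n + 1) ^ 2)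
    (fun n => (Nat.le_succ n).trans (Nat.le_self_pow (by norm_num) _)) M
  convert dvd_add ((pow_dvd_pow X (Nat.le_succ M)).trans h1) h2 using 1
  rw [phi_eq_genFun, genFun_eq_add_of_bijective finiteFibers_natAbs_sq _ _ hb, two_mul]
  nth_rw 2 [Finset.sum_range_succ']
  have e1 : ((fun k : ℤ => k.natAbs ^ 2) ∘ fun n : ℕ => (n : ℤ)) = fun n => n ^ 2 := by
    funext n; simp
  have e2 : ((fun k : ℤ => k.natAbs ^ 2) ∘ fun n : ℕ => -((n : ℤ) + 1)) =
      fun n => (n + 1) ^ 2 := by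
    funext n
    simp only [Function.comp_apply, Int.natAbs_neg]
    norm_cast
  rw [e1, e2]
  ring

theorem X_pow_dvd_phi_sub (M : ℕ) :
    X ^ M ∣ phi - (2 * ∑ n ∈ Finset.range M, X ^ (n ^ 2) - 1) := by
  have h := X_pow_dvd_phi_sub_range_succ M
  rw [Finset.sum_range_succ] at h
  have h2 : (X : ℤ⟦X⟧) ^ M ∣ 2 * X ^ (M ^ 2) :=
    (pow_dvd_pow X (Nat.le_self_pow (by norm_num) M)).mul_left 2
  convert dvd_add h h2 using 1
  ring

theorem X_pow_dvd_phiNeg_sub (M : ℕ) :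
    X ^ M ∣ phiNeg - (2 * ∑ n ∈ Finset.range M, (-1) ^ n * X ^ (n ^ 2) - 1) := by
  have h := map_dvd (rescale (-1 : ℤ)) (X_pow_dvd_phi_sub M)
  -- `n²` and `n` have the same parity.
  have e (n : ℕ) : (-X : ℤ⟦X⟧) ^ (n ^ 2) = (-1) ^ n * X ^ (n ^ 2) := by
    rw [neg_pow]
    congr 1
    rcases Nat.even_or_odd n with hn | hn
    · rw [hn.neg_one_pow, (hn.pow_of_ne_zero two_ne_zero).neg_one_pow]
    · rw [hn.neg_one_pow, hn.pow.neg_one_pow]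
  simp only [map_pow, map_sub, map_mul, map_ofNat, map_one, map_sum, rescale_neg_one_X, e] at h
  rw [neg_pow] at h
  exact (Dvd.intro_left _ rfl).trans h

theorem v0Series_add_rescale_mul :
    (v0Series + rescale (-1) v0Series - 1) * expand 4 (by norm_num) phiNeg =
      expand 2 (by norm_num) phi ^ 2 := by
  -- The argument needs a square root of `-1`, so the identity is proved over `ℂ` and pulled back by
  -- injectivity.
  let r : ℤ⟦X⟧ →+* ℂ⟦X⟧ := map (Int.castRingHom ℂ)
  have hr : Function.Injective r := map_injective _ (RingHom.injective_int _)
  have hrX : r X = X := map_X _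
  apply hr
  rw [← sub_eq_zero]
  suffices h : ∀ M, X ^ M ∣ r ((v0Series + rescale (-1) v0Series - 1) *
      expand 4 (by norm_num) phiNeg) - r (expand 2 (by norm_num) phi ^ 2) by
    ext m
    rw [map_zero]
    exact X_pow_dvd_iff.mp (h (m + 1)) m (Nat.lt_succ_self m)
  intro M
  have hI : Complex.I ^ 2 = -1 := Complex.I_sq
  have hS := X_pow_dvd_v0Series_sub (2 * (M + 1))
  have hS' := map_dvd (rescale (-1 : ℤ)) hS
  have hV : X ^ M ∣ r (v0Series + rescale (-1) v0Series - 1) -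
      bilSum (2 * (M + 1)) (X : ℂ⟦X⟧) := by
    have hc (f : ℤ⟦X⟧) : r (rescale (-1) f) = rescale (-1) (r f) := by
      ext m
      simp [r, coeff_rescale]
    have hT (n : ℕ) : r (v0Term n) = bilTerm X n := map_v0Term n
    rw [map_pow, rescale_neg_one_X, neg_pow] at hS'
    have h := map_dvd r (dvd_add hS ((Dvd.intro_left _ rfl).trans hS'))
    simp only [map_sub, map_add, map_pow, hrX, hc, map_sum, hT, rescale_bilTerm_X] at h
    refine (pow_dvd_pow X (by omega)).trans (h.trans (dvd_of_eq ?_))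
    rw [map_sub, map_add, hc, map_one, bilSum]
    ring
  have hP : X ^ M ∣ r (expand 4 (by norm_num) phiNeg) -
      bilSum (2 * (M + 1)) (C Complex.I * X : ℂ⟦X⟧) := by
    have h := map_dvd (r.comp (expand 4 (by norm_num)).toRingHom) (X_pow_dvd_phiNeg_sub (M + 1))
    rw [bilSum_C_mul_X hI]
    simp only [RingHom.comp_apply, AlgHom.toRingHom_eq_coe, RingHom.coe_coe, map_sub, map_mul,
      map_pow, map_sum, map_one, map_neg, map_ofNat, expand_X, hrX, ← pow_mul] at h
    exact (pow_dvd_pow X (by omega)).trans h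
  have hQ : X ^ M ∣ r (expand 2 (by norm_num) phi) -
      (2 * ∑ n ∈ Finset.range (2 * (M + 1)), X ^ (2 * n ^ 2) - 1) := by
    have h := map_dvd (r.comp (expand 2 (by norm_num)).toRingHom)
      (X_pow_dvd_phi_sub (2 * (M + 1)))
    simp only [RingHom.comp_apply, AlgHom.toRingHom_eq_coe, RingHom.coe_coe, map_sub, map_mul,
      map_pow, map_sum, map_one, map_ofNat, expand_X, hrX, ← pow_mul] at h
    exact (pow_dvd_pow X (by omega)).trans h
  -- This `N` makes the cutoff `N + 1` equal to the even number `2 (M + 1)` used above.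
  have hF := X_pow_dvd_bilSum_mul_bilSum_sub_sq hI (M := M) (N := 2 * M + 1) (by omega)
  have h1 := X_pow_dvd_mul_sub_mul hV hP
  have h2 := X_pow_dvd_mul_sub_mul hQ hQ
  rw [map_mul, map_pow]
  convert dvd_sub (dvd_add h1 hF) h2 using 1
  rw [show 2 * M + 1 + 1 = 2 * (M + 1) by ring]
  ring

/-! ### Extraction of arithmetic progressions. -/

/-- The operator `∑ a(n) q^n ↦ ∑ a(r n + s) q^n`. -/
noncomputable def decim (r s : ℕ) : ℤ⟦X⟧ →+ ℤ⟦X⟧ where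
  toFun f := PowerSeries.mk fun n => coeff (r * n + s) f
  map_add' f g := by ext; simp
  map_zero' := by ext; simp

theorem coeff_decim (r s n : ℕ) (f : ℤ⟦X⟧) : coeff n (decim r s f) = coeff (r * n + s) f := by
  simp [decim]

/-- Multiplying by a series in `q^r` keeps exponents in their residue class modulo `r`. This is why
denominators are first made into series in `q^r`. -/
theorem decim_expand_mul {r s : ℕ} (hr : r ≠ 0) (hs : s < r) (a f : ℤ⟦X⟧) :
    decim r s (expand r hr a * f) = a * decim r s f := by
  ext n
  rw [coeff_decim, coeff_mul, coeff_mul]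
  symm
  refine Finset.sum_of_injOn (fun p => (r * p.1, r * p.2 + s)) ?_ ?_ ?_ ?_
  · rintro ⟨i, j⟩ - ⟨k, l⟩ - h
    simpa [hr] using h
  · rintro ⟨i, j⟩ h
    simp only [Finset.mem_coe, Finset.HasAntidiagonal.mem_antidiagonal] at h ⊢
    rw [← h]
    ring
  · rintro ⟨i, j⟩ h hn
    rw [coeff_expand]
    split_ifs with hd
    · obtain ⟨k, rfl⟩ := hd
      simp only [Finset.HasAntidiagonal.mem_antidiagonal] at h
      have hkn : k ≤ n := by
        by_contra hk
        have : r * (n + 1) ≤ r * k := Nat.mul_le_mul_left r (by omega)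
        rw [mul_add] at this
        omega
      exfalso
      refine hn ⟨(k, n - k), ?_, ?_⟩
      · simp only [Finset.mem_coe, Finset.HasAntidiagonal.mem_antidiagonal]
        omega
      · obtain ⟨l, rfl⟩ := Nat.exists_eq_add_of_le hkn
        rw [mul_add] at h
        simp only [Nat.add_sub_cancel_left, Prod.mk.injEq, true_and]
        omega
    · simp
  · rintro ⟨i, j⟩ -
    simp [coeff_expand_mul, coeff_decim]

theorem decim_X_pow_mul_expand {r s k : ℕ} (hr : r ≠ 0) (hs : s < r) (hk : k < r) (a : ℤ⟦X⟧) :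
    decim r s (X ^ k * expand r hr a) = if k = s then a else 0 := by
  have h : decim r s (X ^ k) = if k = s then 1 else 0 := by
    ext n
    rw [coeff_decim, coeff_X_pow]
    by_cases hn : n = 0
    · subst hn
      simp only [mul_zero, zero_add, eq_comm (a := s)]
      split_ifs <;> simp
    · have : r ≤ r * n := Nat.le_mul_of_pos_right r (by omega)
      rw [if_neg (by omega)]
      split_ifs <;> simp [coeff_one, hn]
  rw [mul_comm, decim_expand_mul hr hs, h]
  split_ifs <;> simp

theorem decim_two_zero_add (a b : ℤ⟦X⟧) :
    decim 2 0 (expand 2 two_ne_zero a + X * expand 2 two_ne_zero b) = a := by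
  have h0 := decim_X_pow_mul_expand (r := 2) (s := 0) (k := 0) two_ne_zero
    (by norm_num) (by norm_num) a
  have h1 := decim_X_pow_mul_expand (r := 2) (s := 0) (k := 1) two_ne_zero
    (by norm_num) (by norm_num) b
  rw [pow_zero, one_mul, if_pos rfl] at h0
  rw [pow_one, if_neg one_ne_zero] at h1
  rw [map_add, h0, h1, add_zero]

theorem decim_two_zero_expand_mul (a f : ℤ⟦X⟧) :
    decim 2 0 (expand 2 two_ne_zero a * f) = a * decim 2 0 f :=
  decim_expand_mul _ (by norm_num) a f

theorem add_rescale_neg_one (f : ℤ⟦X⟧) :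
    f + rescale (-1) f = 2 * expand 2 two_ne_zero (decim 2 0 f) := by
  ext n
  rw [map_add, coeff_rescale, ← map_ofNat C 2, coeff_C_mul, coeff_expand]
  split_ifs with h
  · obtain ⟨m, rfl⟩ := h
    rw [coeff_decim, Nat.mul_div_cancel_left _ (by norm_num), add_zero,
      (even_two_mul m).neg_one_pow]
    ring
  · rw [← even_iff_two_dvd, Nat.not_even_iff_odd] at h
    rw [h.neg_one_pow]
    ring

theorem expand_four (f : ℤ⟦X⟧) :
    expand 4 (by norm_num) f = expand 2 two_ne_zero (expand 2 two_ne_zero f) :=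
  expand_mul 2 two_ne_zero 2 two_ne_zero f

theorem expand_eight (f : ℤ⟦X⟧) :
    expand 8 (by norm_num) f = expand 4 four_ne_zero (expand 2 two_ne_zero f) :=
  expand_mul 4 four_ne_zero 2 two_ne_zero f

theorem expand_two_injective : Function.Injective (expand 2 two_ne_zero : ℤ⟦X⟧ → ℤ⟦X⟧) := by
  intro f g h
  ext n
  rw [← coeff_expand_mul 2 two_ne_zero f, h, coeff_expand_mul]

theorem two_ne_zero_powerSeries : (2 : ℤ⟦X⟧) ≠ 0 := by
  intro h
  have := congrArg constantCoeff h
  rw [map_ofNat, map_zero] at this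
  norm_num at this

theorem rescale_expand_two (f : ℤ⟦X⟧) :
    rescale (-1) (expand 2 two_ne_zero f) = expand 2 two_ne_zero f := by
  ext n
  rw [coeff_rescale, coeff_expand]
  split_ifs with h
  · rw [(even_iff_two_dvd.mpr h).neg_one_pow, one_mul]
  · simp

/-! ### Relations between `φ(q)`, `φ(-q)` and `ψ`. -/

theorem phiNeg_eq :
    phiNeg = expand 4 four_ne_zero phi - 2 * X * expand 4 four_ne_zero (expand 2 two_ne_zero psi)
    := by
  rw [phiNeg]
  conv_lhs => rw [phi_eq_expand_four]
  rw [map_add, map_mul, map_mul, map_ofNat, rescale_neg_one_X, expand_eight, expand_four,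
    expand_four, rescale_expand_two, rescale_expand_two]
  ring

theorem phiNeg_sq_eq :
    phiNeg ^ 2 = expand 2 two_ne_zero phi ^ 2 -
      4 * X * expand 2 two_ne_zero (expand 2 two_ne_zero psi) ^ 2 := by
  rw [phiNeg, ← map_pow, phi_sq_eq, map_add, map_mul, map_mul, map_ofNat, rescale_neg_one_X,
    expand_four, map_pow, map_pow, rescale_expand_two, rescale_expand_two]
  ring

/-- `φ(±q) = φ(q⁴) ± 2q ψ(q⁸)`, and the resulting difference of squares is `phiNeg_sq_eq` with `q²`
for `q`. -/
theorem phi_mul_phiNeg : phi * phiNeg = expand 2 two_ne_zero phiNeg ^ 2 := by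
  have h := congrArg (expand 2 two_ne_zero) phiNeg_sq_eq
  simp only [map_pow, map_sub, map_mul, map_ofNat, expand_X, ← expand_four] at h
  rw [h]
  nth_rw 1 [phiNeg_eq, phi_eq_expand_four, expand_eight]
  rw [expand_four (expand 2 two_ne_zero psi), ← expand_four psi]
  ring

/-- With `a = φ(q²)`, `b = ψ(q⁴)`, the left side is `(a² + 4q b²)² - (a² - 4q b²)² = 16 q a² b²`,
and `a b = ψ(q²)²`. -/
theorem phi_pow_four_sub :
    phi ^ 4 - phiNeg ^ 4 = 16 * X * expand 2 two_ne_zero psi ^ 4 := by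
  have h1 := phi_sq_eq
  have h2 := phiNeg_sq_eq
  have h3 := congrArg (expand 2 two_ne_zero) phi_mul_expand_psi
  rw [map_mul, map_pow] at h3
  rw [expand_four] at h1
  set a := expand 2 two_ne_zero phi
  set b := expand 2 two_ne_zero (expand 2 two_ne_zero psi)
  linear_combination (phi ^ 2 + a ^ 2 + 4 * X * b ^ 2) * h1 -
    (phiNeg ^ 2 + a ^ 2 - 4 * X * b ^ 2) * h2 +
    16 * X * (a * b + expand 2 two_ne_zero psi ^ 2) * h3

/-! ### Successive dissections down to `32n + 4`. -/

theorem decim_two_mul_expand_phiNeg :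
    (2 * decim 2 0 v0Series - 1) * expand 2 two_ne_zero phiNeg = phi ^ 2 := by
  apply expand_two_injective
  have h := v0Series_add_rescale_mul
  rw [add_rescale_neg_one, expand_four] at h
  simpa only [map_mul, map_sub, map_ofNat, map_one, map_pow] using h

theorem decim_one (r s : ℕ) (hr : r ≠ 0) (hs : s < r) :
    decim r s 1 = if s = 0 then 1 else 0 := by
  simpa [eq_comm] using decim_X_pow_mul_expand (k := 0) hr hs (by omega) 1

theorem decim_two_mul (r s : ℕ) (f : ℤ⟦X⟧) : decim r s (2 * f) = 2 * decim r s f := by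
  rw [two_mul, two_mul, map_add]

theorem decim_four_mul_phiNeg :
    (2 * decim 2 0 (decim 2 0 v0Series) - 1) * phiNeg = phi ^ 2 := by
  have h := congrArg (decim 2 0) decim_two_mul_expand_phiNeg
  have e : phi ^ 2 = expand 2 two_ne_zero (phi ^ 2) +
      X * expand 2 two_ne_zero (4 * expand 2 two_ne_zero psi ^ 2) := by
    simp only [map_mul, map_pow, map_ofNat]
    rw [phi_sq_eq, expand_four]
    ring
  rw [mul_comm, decim_two_zero_expand_mul, map_sub, decim_two_mul,
    decim_one _ _ two_ne_zero two_pos, if_pos rfl, e, decim_two_zero_add] at h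
  rw [mul_comm, h]

theorem decim_sixteen_mul_phiNeg_pow :
    decim 4 1 (decim 2 0 (decim 2 0 v0Series)) * phiNeg ^ 4 =
      3 * phi ^ 4 * expand 2 two_ne_zero psi + 16 * X * expand 2 two_ne_zero psi ^ 5 := by
  set E := decim 2 0 (decim 2 0 v0Series) with hE
  have h := decim_four_mul_phiNeg
  have h1 := phi_mul_phiNeg
  have h2 := congrArg (expand 2 two_ne_zero) phi_mul_phiNeg
  rw [map_mul, map_pow, ← expand_four] at h2
  have h3 := congrArg (expand 2 two_ne_zero) phi_sq_eq
  simp only [map_pow, map_add, map_mul, map_ofNat, expand_X, ← expand_four] at h3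
  have h4 : expand 2 two_ne_zero (expand 4 four_ne_zero psi) =
    expand 4 four_ne_zero (expand 2 two_ne_zero psi) := by
    rw [expand_four, expand_four]
  have h5 := phi_eq_expand_four
  rw [expand_eight] at h5
  rw [← hE] at h
  set Q := expand 2 two_ne_zero psi
  -- Multiplying by `φ(q) φ(q²)²` turns `φ(-q)` into `φ(-q⁴)⁴`; the right side becomes `φ(q)³
  -- φ(q²)²`, expanded in `φ(q⁴)` and `ψ(q⁸)`.
  have key : (2 * E - 1) * expand 4 four_ne_zero (phiNeg ^ 4) =
      (expand 4 four_ne_zero phi + 2 * X * expand 4 four_ne_zero Q) ^ 3 *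
        (expand 4 four_ne_zero phi ^ 2 + 4 * X ^ 2 * expand 4 four_ne_zero Q ^ 2) := by
    rw [← h5, ← h4, ← h3, map_pow]
    set p2 := expand 2 two_ne_zero phi
    set n2 := expand 2 two_ne_zero phiNeg
    set n4 := expand 4 four_ne_zero phiNeg
    linear_combination -(2 * E - 1) * (n4 ^ 2 + p2 * n2) * h2 +
      phi * p2 ^ 2 * h - (2 * E - 1) * p2 ^ 2 * h1
  have e : (expand 4 four_ne_zero phi + 2 * X * expand 4 four_ne_zero Q) ^ 3 *
        (expand 4 four_ne_zero phi ^ 2 + 4 * X ^ 2 * expand 4 four_ne_zero Q ^ 2) =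
      X ^ 0 * expand 4 four_ne_zero (phi ^ 5 + 48 * X * phi * Q ^ 4) +
      X ^ 1 * expand 4 four_ne_zero (6 * phi ^ 4 * Q + 32 * X * Q ^ 5) +
      X ^ 2 * expand 4 four_ne_zero (16 * phi ^ 3 * Q ^ 2) +
      X ^ 3 * expand 4 four_ne_zero (32 * phi ^ 2 * Q ^ 3) := by
    simp only [map_add, map_mul, map_pow, map_ofNat, expand_X]
    ring
  rw [e] at key
  have key2 := congrArg (decim 4 1) key
  rw [mul_comm, decim_expand_mul _ (by norm_num), map_sub, decim_two_mul,
    decim_one _ _ four_ne_zero (by norm_num)] at key2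
  simp only [map_add (decim 4 1)] at key2
  rw [decim_X_pow_mul_expand _ (by norm_num) (by norm_num),
    decim_X_pow_mul_expand _ (by norm_num) (by norm_num),
    decim_X_pow_mul_expand _ (by norm_num) (by norm_num),
    decim_X_pow_mul_expand _ (by norm_num) (by norm_num)] at key2
  norm_num at key2
  exact mul_left_cancel₀ two_ne_zero_powerSeries (by linear_combination key2)

theorem decim_thirtyTwo_mul_phiNeg_pow :
    decim 2 0 (decim 4 1 (decim 2 0 (decim 2 0 v0Series))) * phiNeg ^ 8 =
      3 * psi * phiNeg ^ 8 + 512 * X * psi ^ 9 := by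
  set W := decim 4 1 (decim 2 0 (decim 2 0 v0Series)) with hW
  have h := decim_sixteen_mul_phiNeg_pow
  rw [← hW] at h
  have h1 := phi_mul_phiNeg
  have h2 := phi_sq_eq
  have h3 := phi_mul_expand_psi
  have h4 := phi_pow_four_sub
  rw [expand_four] at h2
  set Q := expand 2 two_ne_zero psi
  -- Multiplying by `φ(q)⁴` turns `φ(-q)⁴` into `φ(-q²)⁸`. Only even powers of `φ(q)` remain, so
  -- `phi_sq_eq` separates the parities.
  have key : expand 2 two_ne_zero (phiNeg ^ 8) * W =
      expand 2 two_ne_zero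
        (3 * psi * (phi ^ 8 + 96 * X * phi ^ 4 * Q ^ 4 + 256 * X ^ 2 * Q ^ 8) +
          128 * X * phi ^ 2 * Q ^ 2 * psi ^ 5) +
      X * expand 2 two_ne_zero
        (3 * psi * (16 * phi ^ 6 * Q ^ 2 + 256 * X * phi ^ 2 * Q ^ 6) +
          16 * psi ^ 5 * (phi ^ 4 + 16 * X * Q ^ 4)) := by
    have e1 : expand 2 two_ne_zero (phiNeg ^ 8) * W =
        3 * (phi ^ 2) ^ 4 * Q + 16 * X * Q ^ 5 * (phi ^ 2) ^ 2 := by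
      have e2 : expand 2 two_ne_zero (phiNeg ^ 8) = (phi * phiNeg) ^ 4 := by
        rw [h1, map_pow]; ring
      rw [e2]
      linear_combination phi ^ 4 * h
    have hQ : expand 2 two_ne_zero psi = Q := rfl
    rw [e1]
    simp only [map_add, map_mul, map_pow, map_ofNat, expand_X, hQ]
    rw [h2]
    ring
  have key2 := congrArg (decim 2 0) key
  rw [decim_two_zero_expand_mul, decim_two_zero_add] at key2
  have h5 : phi ^ 8 + 256 * X ^ 2 * Q ^ 8 = phiNeg ^ 8 + 32 * X * psi ^ 8 := by
    have h6 : phi ^ 4 * Q ^ 4 = psi ^ 8 := by rw [← mul_pow, h3]; ring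
    linear_combination (phi ^ 4 - 16 * X * Q ^ 4 + phiNeg ^ 4) * h4 + 32 * X * h6
  have h6 : phi ^ 4 * Q ^ 4 = psi ^ 8 := by rw [← mul_pow, h3]; ring
  have h7 : phi ^ 2 * Q ^ 2 = psi ^ 4 := by rw [← mul_pow, h3]; ring
  -- The coefficient of `q ψ⁹` is `3·32 + 288 + 128 = 512`.
  linear_combination key2 + 3 * psi * h5 + 288 * X * psi * h6 + 128 * X * psi ^ 5 * h7

end MockThetaV0

theorem mainTheorem12 :
    (PowerSeries.mk fun n => MockThetaV0.v0 (32 * n + 4)) =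
      3 * MockThetaV0.psi +
        512 * PowerSeries.X *
          (MockThetaV0.psi ^ 9 * PowerSeries.invOfUnit (MockThetaV0.phiNeg ^ 8) 1) := by
  have e : (PowerSeries.mk fun n => MockThetaV0.v0 (32 * n + 4)) =
      MockThetaV0.decim 2 0 (MockThetaV0.decim 4 1 (MockThetaV0.decim 2 0
        (MockThetaV0.decim 2 0 MockThetaV0.v0Series))) := by
    ext n
    simp only [MockThetaV0.coeff_decim, MockThetaV0.v0Series, PowerSeries.coeff_mk]
    congr 1
    ring
  have h := MockThetaV0.decim_thirtyTwo_mul_phiNeg_pow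
  have hi := MockThetaV0.phiNeg_pow_mul_inv
  rw [← e] at h
  generalize PowerSeries.invOfUnit (MockThetaV0.phiNeg ^ 8) 1 = w at *
  generalize (PowerSeries.mk fun n => MockThetaV0.v0 (32 * n + 4)) = L at *
  linear_combination w * h + (3 * MockThetaV0.psi - L) * hi
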